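/- Let $N,K\ge 1$ be integers. A locally decodable code (LDC) of length $M$ with locality $N$ consists of: $K$ independent random source symbols $W_1,\dots,W_K$ with values in a finite alphabet and with a common entropy $H(W_1)=\dots=H(W_K)=L_w$ (in bits); a deterministic map from $(W_1,\dots,W_K)$ to $M$ coded symbols $X_1,\dots,X_M$ with values in a finite alphabet and with a common entropy $H(X_1)=\dots=H(X_M)=L_x>0$; and, for each $k$, a non-empty collection $\mathcal S_k$ of sets $S$ of exactly $N$ of the $M$ coded symbols (i.e. of their indices) such that $H(W_k\mid S)=0$. The LDC is perfectly smooth (an SLDC) if for every $k$ all coded symbols appear in the same number of sets of $\mathcal S_k$. Let $C_{\mathrm{SLDC}}(N,K,M)$ be the supremum of the symbol rates $L_w/L_x$ of all SLDCs of length $M$ with locality $N$ and $K$ source symbols ($-\infty$ if there are none), and let $C^*_{\mathrm{SLDC}}(N,K)=\sup_{M\in\mathbb N}C_{\mathrm{SLDC}}(N,K,M)$. Then $C^*_{\mathrm{SLDC}}(N,K)=N\left(1+\frac1N+\dots+\frac1{N^{K-1}}\right)^{-1}$, and $$\min\{M \mid C_{\mathrm{SLDC}}(N,K,M)=C^*_{\mathrm{SLDC}}(N,K)\}=N^K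 .$$ Moreover, $N^K$ is also the minimum length $M$ of an SLDC with locality $N$ and $K$ source symbols whose symbol rate $L_w/L_x$ is equal to $C^*_{\mathrm{SLDC}}(N,K)$. -/

import Mathlib

open MeasureTheory

/-- Shannon entropy `H(Y)`, in bits, of a random variable with values in a finite alphabet:
`- ∑ y, P(Y = y) log₂ P(Y = y)`. -/
noncomputable def entropy {Ω β : Type} [MeasurableSpace Ω] [Fintype β]
    (P : Measure Ω) (Y : Ω → β) : ℝ :=
  -∑ y, P.real {ω | Y ω = y} * Real.logb 2 (P.real {ω | Y ω = y})

/-- Conditional Shannon entropy `H(Y | Z)`, in bits: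
`- ∑ z, ∑ y, P(Y = y, Z = z) log₂ (P(Y = y, Z = z) / P(Z = z))`
(terms with `P(Y = y, Z = z) = 0` vanish). -/
noncomputable def condEntropy {Ω β γ : Type} [MeasurableSpace Ω] [Fintype β] [Fintype γ]
    (P : Measure Ω) (Y : Ω → β) (Z : Ω → γ) : ℝ :=
  -∑ z, ∑ y, P.real {ω | Y ω = y ∧ Z ω = z} *
    Real.logb 2 (P.real {ω | Y ω = y ∧ Z ω = z} / P.real {ω | Z ω = z})

/-- The coded symbol `X m` produced by the encoding map `enc` from the source symbols `W`. -/
def codedSymbol {Ω A B : Type} {K M : ℕ} (W : Fin K → Ω → A)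
    (enc : (Fin K → A) → Fin M → B) (m : Fin M) (ω : Ω) : B :=
  enc (fun k => W k ω) m

/-- `IsLDC N P W enc 𝒮 Lw Lx`: the source symbols `W k` (random variables with values in a finite
alphabet `A`), the encoding map `enc`, and the decoding supersets `𝒮 k` form a locally decodable
code with locality `N`, source symbols of `Lw` bits and coded symbols of `Lx` bits. A set of coded
symbols is given by the set of its indices. A common finite alphabet for all source symbols, and one
for all coded symbols, is no restriction, since sizes are measured by entropy and the symbols need
not take all the values in the alphabet. -/
structure IsLDC {Ω A B : Type} [MeasurableSpace Ω] [Fintype A] [Fintype B] {K M : ℕ} (N : ℕ)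
    (P : Measure Ω) (W : Fin K → Ω → A) (enc : (Fin K → A) → Fin M → B)
    (𝒮 : Fin K → Finset (Finset (Fin M))) (Lw Lx : ℝ) : Prop where
  /-- the underlying space is a probability space -/
  isProbabilityMeasure : IsProbabilityMeasure P
  /-- the source symbols are random variables -/
  measurableSet_source : ∀ k a, MeasurableSet {ω | W k ω = a}
  /-- the source symbols are independent -/
  entropy_sources : entropy P (fun ω k => W k ω) = ∑ k, entropy P (W k)
  /-- every source symbol has size `Lw` -/
  entropy_source : ∀ k, entropy P (W k) = Lw
  /-- every coded symbol has size `Lx` -/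
  entropy_coded : ∀ m, entropy P (codedSymbol W enc m) = Lx
  /-- every source symbol has a decoding set -/
  nonempty : ∀ k, (𝒮 k).Nonempty
  /-- decoding sets consist of `N` coded symbols -/
  card_eq : ∀ k, ∀ S ∈ 𝒮 k, S.card = N
  /-- `H(W k | S) = 0` for every decoding set `S` of `W k` -/
  decodable : ∀ k, ∀ S ∈ 𝒮 k,
    condEntropy P (W k) (fun ω (m : {m // m ∈ S}) => codedSymbol W enc m ω) = 0

/-- Perfect smoothness of the decoding supersets: for every source symbol, all coded symbols
appear in the same number of its decoding sets. -/
def PerfectlySmooth {K M : ℕ} (𝒮 : Fin K → Finset (Finset (Fin M))) : Prop :=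
  ∀ (k : Fin K) (m m' : Fin M),
    ((𝒮 k).filter fun S => m ∈ S).card = ((𝒮 k).filter fun S => m' ∈ S).card

/-- The symbol rates `Lw / Lx` of all perfectly smooth locally decodable codes with locality `N`,
`K` source symbols and code length `M`. -/
def smoothRates (N K M : ℕ) : Set ℝ :=
  {r | ∃ (Ω A B : Type) (_ : MeasurableSpace Ω) (_ : Fintype A) (_ : Fintype B)
      (P : Measure Ω) (W : Fin K → Ω → A) (enc : (Fin K → A) → Fin M → B)
      (𝒮 : Fin K → Finset (Finset (Fin M))) (Lw Lx : ℝ),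
      IsLDC N P W enc 𝒮 Lw Lx ∧ PerfectlySmooth 𝒮 ∧ 0 < Lx ∧ r = Lw / Lx}

/-- The capacity `C(N, K, M)`: the supremum of the symbol rates of perfectly smooth locally
decodable codes, in the extended reals (it is `⊥` if there is no such code). -/
noncomputable def smoothCapacity (N K M : ℕ) : EReal :=
  sSup ((fun r : ℝ => (r : EReal)) '' smoothRates N K M)

/-- The maximal capacity `C*(N, K)` over all code lengths `M`. -/
noncomputable def maxSmoothCapacity (N K : ℕ) : EReal :=
  ⨆ M : ℕ, smoothCapacity N K M

/-!
The upper bound concerns the conditional entropies `g j S = H(X_S | W_0, …, W_(j-1)) / Lx` of sets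
`S` of coded symbols. If `S` decodes `W_j`, then `g j S = w + g (j + 1) S` with `w = Lw / Lx`.
Bounding the left side above by the sum of the entropies of the members of `S`, bounding the right
side below by their average, and averaging over the decoding sets, which by smoothness weigh all
coded symbols equally, gives `N a_j ≥ w + a_(j+1)` for the average `a_j` of `g j {m}` over `m`.
As `a_0 = 1` and `a_K = 0`, this unrolls to the bound on the rate (`IsProfile.rate_le`).

If the bound is attained, nothing is lost in these steps: given the first `j` source symbols, all
coded symbols have the same entropy and the members of a decoding set of `W_j` are independent,
while given `W_j` as well they determine each other. Hence the classes of coded symbols that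
determine each other given the first `j` source symbols grow at least `N`-fold from `j` to `j + 1`,
and there are at least `N ^ K` coded symbols (`IsProfile.pow_le_length`).

A code need not exist at a supremum of rates. But the argument uses only linear inequalities between
the numbers `g j S` (`IsProfile`), which by compactness have a solution at any limit of rates of
codes of a fixed length (`isClosed_profileRates`). So a length less than `N ^ K` has capacity
strictly below the maximum.

The bound is attained by `N ^ K` coded symbols indexed by the points `m` of a grid, the decoding
sets of `W_k` being the lines of direction `k` (`grid_rate_mem`). The basic symbol at `m` is the sum
over `j` of the bit of `W_j` with number `m j`, where one of the `N` bits of each source symbol is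
fixed to be zero. This makes one of the coded symbols constant; using `N ^ K` codes in parallel,
with the constant symbol in each of the possible places, makes all entropies equal.
-/

/-! ### Entropy of partitions of a finite weighted set -/

section PartitionEntropy

open Classical

variable {V : Type*} [Fintype V]

/-- The total weight of the block of the partition `r` that contains `v`. -/
noncomputable def blockMass (p : V → ℝ) (r : Setoid V) (v : V) : ℝ :=
  ∑ u, if r u v then p u else 0

/-- The entropy, in bits, of the partition `r` of a set with weights `p`, written as the expectation
of `- log₂` of the weight of the block of a random point. A random variable on a finite probability
space is represented by its kernel, so that `r ⊓ s` is the pair of the variables `r` and `s`, and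
`r ≤ s` says that `r` determines `s`. -/
noncomputable def partitionEntropy (p : V → ℝ) (r : Setoid V) : ℝ :=
  -∑ v, p v * Real.logb 2 (blockMass p r v)

variable {p : V → ℝ} {r s t : Setoid V}

lemma blockMass_nonneg (hp : ∀ v, 0 ≤ p v) (r : Setoid V) (v : V) : 0 ≤ blockMass p r v :=
  Finset.sum_nonneg fun u _ => by split_ifs <;> simp [hp u]

lemma le_blockMass (hp : ∀ v, 0 ≤ p v) (r : Setoid V) (v : V) : p v ≤ blockMass p r v := by
  have h := Finset.single_le_sum (f := fun u => if r u v then p u else 0)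
    (fun u _ => by split_ifs <;> simp [hp u]) (Finset.mem_univ v)
  simpa [r.refl v, blockMass] using h

lemma blockMass_mono (hp : ∀ v, 0 ≤ p v) (h : r ≤ s) (v : V) :
    blockMass p r v ≤ blockMass p s v := by
  refine Finset.sum_le_sum fun u _ => ?_
  by_cases hr : r u v
  · simp [hr, h hr]
  · split_ifs <;> simp [hp u]

lemma blockMass_congr {u v : V} (h : r u v) : blockMass p r u = blockMass p r v := by
  refine Finset.sum_congr rfl fun x _ => ?_
  have : r x u ↔ r x v := ⟨fun hx => r.trans hx h, fun hx => r.trans hx (r.symm h)⟩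
  simp [this]

lemma partitionEntropy_anti (hp : ∀ v, 0 ≤ p v) (h : r ≤ s) :
    partitionEntropy p s ≤ partitionEntropy p r := by
  refine neg_le_neg (Finset.sum_le_sum fun v _ => ?_)
  rcases (hp v).eq_or_lt with h0 | h0
  · simp [← h0]
  · have hr : 0 < blockMass p r v := h0.trans_le (le_blockMass hp r v)
    exact mul_le_mul_of_nonneg_left
      (Real.logb_le_logb_of_le one_lt_two hr (blockMass_mono hp h v)) h0.le

lemma partitionEntropy_top (hp : ∑ v, p v = 1) : partitionEntropy p ⊤ = 0 := by
  simp [partitionEntropy, blockMass, hp, Setoid.top_def]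

/-- The measure under which `r` and `s` are independent given `t`, with their own conditional laws,
has total mass at most that of `p`; the sum is its mass on the pairs of values that occur under
`p`. -/
lemma sum_condProduct_le (hp : ∀ v, 0 ≤ p v) (hr : r ≤ t) (hs : s ≤ t) :
    ∑ v, p v * (blockMass p r v * blockMass p s v / (blockMass p (r ⊓ s) v * blockMass p t v))
      ≤ ∑ v, p v := by
  have expand : ∀ v,
      p v * (blockMass p r v * blockMass p s v / (blockMass p (r ⊓ s) v * blockMass p t v))
      = ∑ u, ∑ x, p u * p x * (if r u v ∧ s x v then
          p v / (blockMass p (r ⊓ s) v * blockMass p t v) else 0) := by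
    intro v
    conv_lhs => rw [blockMass, blockMass, Finset.sum_mul_sum, Finset.sum_div, Finset.mul_sum]
    refine Finset.sum_congr rfl fun u _ => ?_
    rw [Finset.sum_div, Finset.mul_sum]
    refine Finset.sum_congr rfl fun x _ => ?_
    by_cases h1 : r u v <;> by_cases h2 : s x v <;> simp [h1, h2]
    ring
  -- Points that are `r`-related to `u` and `s`-related to `x` form a block of `r ⊓ s`, or none.
  have inner : ∀ u x, (∑ v, if r u v ∧ s x v then
        p v / (blockMass p (r ⊓ s) v * blockMass p t v) else 0)
      ≤ if t x u then 1 / blockMass p t u else 0 := by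
    intro u x
    by_cases hne : ∃ v, r u v ∧ s x v
    · obtain ⟨v₀, h1, h2⟩ := hne
      have htu : t x u := t.trans (hs h2) (t.symm (hr h1))
      have : (∑ v, if r u v ∧ s x v then
          p v / (blockMass p (r ⊓ s) v * blockMass p t v) else 0)
          = blockMass p (r ⊓ s) v₀ / (blockMass p (r ⊓ s) v₀ * blockMass p t u) := by
        conv_rhs => rw [blockMass, Finset.sum_div]
        refine Finset.sum_congr rfl fun v _ => ?_
        have hiff : (r u v ∧ s x v) ↔ (r ⊓ s) v v₀ :=
          ⟨fun h => ⟨r.trans (r.symm h.1) h1, s.trans (s.symm h.2) h2⟩,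
            fun h => ⟨r.trans h1 (r.symm h.1), s.trans h2 (s.symm h.2)⟩⟩
        by_cases hv : (r ⊓ s) v v₀
        · rw [if_pos (hiff.2 hv), if_pos hv]
          have e1 := blockMass_congr (p := p) hv
          have e2 := blockMass_congr (p := p) (hr (hiff.2 hv).1)
          rw [e1, ← e2]
          rfl
        · rw [if_neg (fun h => hv (hiff.1 h)), if_neg hv, zero_div]
      rw [this, if_pos htu, ← div_div]
      exact div_le_div_of_nonneg_right (div_self_le_one _) (blockMass_nonneg hp t u)
    · rw [Finset.sum_eq_zero fun v _ => if_neg fun h => hne ⟨v, h⟩]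
      split_ifs
      · exact one_div_nonneg.2 (blockMass_nonneg hp t u)
      · exact le_rfl
  calc _ = ∑ u, ∑ x, p u * p x * ∑ v, (if r u v ∧ s x v then
          p v / (blockMass p (r ⊓ s) v * blockMass p t v) else 0) := by
        rw [Finset.sum_congr rfl fun v _ => expand v, Finset.sum_comm]
        refine Finset.sum_congr rfl fun u _ => ?_
        rw [Finset.sum_comm]
        refine Finset.sum_congr rfl fun x _ => ?_
        rw [Finset.mul_sum]
    _ ≤ ∑ u, ∑ x, p u * p x * (if t x u then 1 / blockMass p t u else 0) :=
        Finset.sum_le_sum fun u _ => Finset.sum_le_sum fun x _ =>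
          mul_le_mul_of_nonneg_left (inner u x) (mul_nonneg (hp u) (hp x))
    _ = ∑ u, p u * (blockMass p t u / blockMass p t u) := by
        refine Finset.sum_congr rfl fun u _ => ?_
        conv_rhs => rw [blockMass, Finset.sum_div, Finset.mul_sum]
        refine Finset.sum_congr rfl fun x _ => ?_
        by_cases h : t x u <;> simp [h, blockMass]
        ring
    _ ≤ ∑ u, p u := Finset.sum_le_sum fun u _ =>
        mul_le_of_le_one_right (hp u) (div_self_le_one _)

/-- Submodularity of entropy: the mutual information of `r` and `s` given a variable `t` that is
determined by each of them is nonnegative. -/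
lemma partitionEntropy_submodular (hp : ∀ v, 0 ≤ p v) (hr : r ≤ t) (hs : s ≤ t) :
    partitionEntropy p (r ⊓ s) + partitionEntropy p t
      ≤ partitionEntropy p r + partitionEntropy p s := by
  have hlog : 0 < Real.log 2 := Real.log_pos one_lt_two
  have pointwise : ∀ v, p v * (Real.log (blockMass p r v) + Real.log (blockMass p s v)
      - Real.log (blockMass p (r ⊓ s) v) - Real.log (blockMass p t v))
      ≤ p v * (blockMass p r v * blockMass p s v / (blockMass p (r ⊓ s) v * blockMass p t v))
        - p v := by
    intro v
    rcases (hp v).eq_or_lt with h0 | h0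
    · simp [← h0]
    · have q : ∀ r : Setoid V, 0 < blockMass p r v := fun r => h0.trans_le (le_blockMass hp r v)
      have h := Real.log_le_sub_one_of_pos
        (div_pos (mul_pos (q r) (q s)) (mul_pos (q (r ⊓ s)) (q t)))
      rw [Real.log_div (mul_pos (q r) (q s)).ne' (mul_pos (q _) (q t)).ne',
        Real.log_mul (q r).ne' (q s).ne', Real.log_mul (q _).ne' (q t).ne'] at h
      have := mul_le_mul_of_nonneg_left h h0.le
      linarith
  have hsum := Finset.sum_le_sum fun v (_ : v ∈ Finset.univ) => pointwise v
  rw [Finset.sum_sub_distrib] at hsum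
  have hsum' := hsum.trans (sub_nonpos.2 (sum_condProduct_le hp hr hs))
  have key : partitionEntropy p (r ⊓ s) + partitionEntropy p t
      - (partitionEntropy p r + partitionEntropy p s)
      = (∑ v, p v * (Real.log (blockMass p r v) + Real.log (blockMass p s v)
      - Real.log (blockMass p (r ⊓ s) v) - Real.log (blockMass p t v))) / Real.log 2 := by
    simp only [partitionEntropy, Real.logb, Finset.sum_div, ← Finset.sum_neg_distrib,
      ← Finset.sum_add_distrib, ← Finset.sum_sub_distrib]
    refine Finset.sum_congr rfl fun v _ => ?_
    ring
  have := div_nonpos_of_nonpos_of_nonneg hsum' hlog.le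
  linarith

end PartitionEntropy

/-! ### Conditional entropy profiles and the converse -/

/-- The properties of the normalized conditional entropies `g j S = H(X_S | W_0, …, W_(j-1)) / Lx`
of the coded symbols of a code of rate `w` with decoding sets `𝒮` that the converse needs. They are
linear (in)equalities in `(w, g)`, and so survive limits of codes of a fixed length. -/
structure IsProfile {K M : ℕ} (𝒮 : Fin K → Finset (Finset (Fin M))) (w : ℝ)
    (g : ℕ → Finset (Fin M) → ℝ) : Prop where
  empty : ∀ j, g j ∅ = 0
  mono : ∀ j S T, S ⊆ T → g j S ≤ g j T
  submodular : ∀ j S T, g j (S ∪ T) + g j (S ∩ T) ≤ g j S + g j T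
  /-- conditioning on one more source symbol does not increase `H(X_T | X_S, W_0, …, W_(j-1))` -/
  conditioning : ∀ j S T, S ⊆ T → g (j + 1) T + g j S ≤ g j T + g (j + 1) S
  zero_singleton : ∀ m, g 0 {m} = 1
  last_singleton : ∀ m, g K {m} = 0
  /-- a decoding set of `W_j` carries `w` units of information on `W_j` -/
  decode : ∀ (j : Fin K), ∀ S ∈ 𝒮 j, g j S = w + g (j + 1) S

namespace IsProfile

variable {K M N : ℕ} {𝒮 : Fin K → Finset (Finset (Fin M))} {w : ℝ} {g : ℕ → Finset (Fin M) → ℝ}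

lemma nonneg (h : IsProfile 𝒮 w g) (j : ℕ) (S : Finset (Fin M)) : 0 ≤ g j S :=
  (h.empty j).symm.trans_le (h.mono j ∅ S (Finset.empty_subset S))

lemma le_add_sum (h : IsProfile 𝒮 w g) (j : ℕ) (S T : Finset (Fin M)) :
    g j (S ∪ T) ≤ g j S + ∑ m ∈ T, g j {m} := by
  induction T using Finset.induction_on with
  | empty => simp
  | insert a T ha ih =>
    have h1 := h.submodular j (S ∪ T) {a}
    have h2 := h.nonneg j ((S ∪ T) ∩ {a})
    have e : S ∪ insert a T = S ∪ T ∪ {a} := by ext; simp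
    rw [e, Finset.sum_insert ha]
    linarith

lemma le_sum (h : IsProfile 𝒮 w g) (j : ℕ) (S : Finset (Fin M)) :
    g j S ≤ ∑ m ∈ S, g j {m} := by
  simpa [h.empty] using h.le_add_sum j ∅ S

lemma succ_le (h : IsProfile 𝒮 w g) (j : ℕ) (S : Finset (Fin M)) : g (j + 1) S ≤ g j S := by
  have := h.conditioning j ∅ S (Finset.empty_subset S)
  rw [h.empty, h.empty] at this
  linarith

lemma le_length (h : IsProfile 𝒮 w g) (j : ℕ) (S : Finset (Fin M)) : g j S ≤ M := by
  have h0 : g 0 S ≤ M := by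
    refine (h.le_sum 0 S).trans ?_
    simp only [h.zero_singleton, Finset.sum_const, nsmul_eq_mul, mul_one]
    exact_mod_cast (Finset.card_le_univ S).trans_eq (Fintype.card_fin M)
  induction j with
  | zero => exact h0
  | succ j ih => exact (h.succ_le j S).trans ih

/-- If all coded symbols have the same conditional entropy `a`, then `g j {x, y} ≤ a` says that `x`
and `y` determine each other given the first `j` source symbols, which is a transitive relation. -/
lemma pair_trans (h : IsProfile 𝒮 w g) {j : ℕ} {a : ℝ} (ha : ∀ m, g j {m} = a) {x y z : Fin M}
    (hxy : g j {x, y} ≤ a) (hyz : g j {y, z} ≤ a) : g j {x, z} ≤ a := by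
  have h1 := h.submodular j {x, y} {y, z}
  have h2 : g j {x, z} ≤ g j ({x, y} ∪ {y, z}) := h.mono j _ _ (by intro; simp; tauto)
  have h3 : g j {y} ≤ g j ({x, y} ∩ {y, z}) := h.mono j _ _ (by intro; simp; tauto)
  rw [ha] at h3
  linarith

end IsProfile

/-- Double counting for smooth decoding sets: the average over the decoding sets of `W_k` of the sum
of `f` over a set is `N` times the average of `f` over all coded symbols. -/
lemma PerfectlySmooth.sum_sum {K M N : ℕ} {𝒮 : Fin K → Finset (Finset (Fin M))}
    (hsm : PerfectlySmooth 𝒮) (k : Fin K) (hcard : ∀ S ∈ 𝒮 k, S.card = N) (f : Fin M → ℝ) :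
    M * ∑ S ∈ 𝒮 k, ∑ m ∈ S, f m = (𝒮 k).card * N * ∑ m, f m := by
  have swap : ∀ f : Fin M → ℝ, ∑ S ∈ 𝒮 k, ∑ m ∈ S, f m
      = ∑ m, ((𝒮 k).filter fun S => m ∈ S).card * f m := by
    intro f
    have : ∀ S ∈ 𝒮 k, ∑ m ∈ S, f m = ∑ m, if m ∈ S then f m else 0 := by
      intro S _
      simp
    rw [Finset.sum_congr rfl this, Finset.sum_comm]
    refine Finset.sum_congr rfl fun m _ => ?_
    rw [← Finset.sum_filter, Finset.sum_const, nsmul_eq_mul]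
  rcases Nat.eq_zero_or_pos M with rfl | hM
  · simp
  let m₀ : Fin M := ⟨0, hM⟩
  set d := ((𝒮 k).filter fun S => m₀ ∈ S).card with hd
  have hconst : ∀ f : Fin M → ℝ, ∑ S ∈ 𝒮 k, ∑ m ∈ S, f m = d * ∑ m, f m := by
    intro f
    rw [swap, Finset.mul_sum]
    exact Finset.sum_congr rfl fun m _ => by rw [hsm k m m₀]
  have hone := hconst fun _ => 1
  rw [Finset.sum_congr rfl fun S hS => show ∑ _m ∈ S, (1 : ℝ) = N by simp [hcard S hS]] at hone
  simp only [Finset.sum_const, nsmul_eq_mul, Finset.card_univ, Fintype.card_fin, mul_one] at hone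
  rw [hconst, hone]
  ring

/-- Every coded symbol lies in a decoding set of every source symbol. -/
lemma PerfectlySmooth.exists_mem {K M N : ℕ} {𝒮 : Fin K → Finset (Finset (Fin M))}
    (hsm : PerfectlySmooth 𝒮) (hN : 1 ≤ N) (k : Fin K) (hne : (𝒮 k).Nonempty)
    (hcard : ∀ S ∈ 𝒮 k, S.card = N) (m : Fin M) : ∃ S ∈ 𝒮 k, m ∈ S := by
  obtain ⟨S, hS⟩ := hne
  obtain ⟨x, hx⟩ : S.Nonempty := Finset.card_pos.1 (by rw [hcard S hS]; exact hN)
  have h1 : 0 < ((𝒮 k).filter fun S => x ∈ S).card :=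
    Finset.card_pos.2 ⟨S, Finset.mem_filter.2 ⟨hS, hx⟩⟩
  rw [hsm k x m] at h1
  obtain ⟨T, hT⟩ := Finset.card_pos.1 h1
  exact ⟨T, (Finset.mem_filter.1 hT).1, (Finset.mem_filter.1 hT).2⟩

namespace IsProfile

variable {K M N : ℕ} {𝒮 : Fin K → Finset (Finset (Fin M))} {w : ℝ} {g : ℕ → Finset (Fin M) → ℝ}

/-- The average over all coded symbols of the conditional entropy given the first `j` source
symbols. -/
noncomputable def average (g : ℕ → Finset (Fin M) → ℝ) (j : ℕ) : ℝ := (∑ m, g j {m}) / M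

lemma average_nonneg (h : IsProfile 𝒮 w g) (j : ℕ) : 0 ≤ average g j :=
  div_nonneg (Finset.sum_nonneg fun _ _ => h.nonneg j _) (Nat.cast_nonneg M)

/-- The two losses of a decoding set `S` of `W_j`: its symbols may be dependent given the first `j`
source symbols, and one of them may fail to determine the others given `W_j` as well. Their average
is the slack of the recursion `N a_j ≥ w + a_(j+1)` for the averages. -/
lemma sum_losses (h : IsProfile 𝒮 w g) (hsm : PerfectlySmooth 𝒮) (hM : 0 < M) (j : Fin K)
    (hcard : ∀ S ∈ 𝒮 j, S.card = N) :
    ∑ S ∈ 𝒮 j, (N * (∑ m ∈ S, g j {m} - g j S)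
        + ∑ m ∈ S, (g (j + 1) S - g (j + 1) {m}))
      = (𝒮 j).card * N * (N * average g j - (w + average g (j + 1))) := by
  have hM' : (M : ℝ) ≠ 0 := by exact_mod_cast hM.ne'
  have avg : ∀ i, ∑ S ∈ 𝒮 j, ∑ m ∈ S, g i {m} = (𝒮 j).card * N * average g i := by
    intro i
    have := hsm.sum_sum j hcard fun m => g i {m}
    rw [average]
    field_simp
    linarith
  have term : ∀ S ∈ 𝒮 j, (N * (∑ m ∈ S, g j {m} - g j S)
        + ∑ m ∈ S, (g (j + 1) S - g (j + 1) {m}))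
      = N * ∑ m ∈ S, g j {m} - (N * w + ∑ m ∈ S, g (j + 1) {m}) := by
    intro S hS
    rw [Finset.sum_sub_distrib, Finset.sum_const, nsmul_eq_mul, hcard S hS, h.decode j S hS]
    ring
  rw [Finset.sum_congr rfl term, Finset.sum_sub_distrib, ← Finset.mul_sum, Finset.sum_add_distrib,
    avg, avg, Finset.sum_const, nsmul_eq_mul]
  ring

lemma loss_nonneg (h : IsProfile 𝒮 w g) (j : ℕ) (S : Finset (Fin M)) :
    0 ≤ N * (∑ m ∈ S, g j {m} - g j S) + ∑ m ∈ S, (g (j + 1) S - g (j + 1) {m}) :=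
  add_nonneg (mul_nonneg (Nat.cast_nonneg N) (sub_nonneg.2 (h.le_sum j S)))
    (Finset.sum_nonneg fun _ hm => sub_nonneg.2 (h.mono _ _ _ (Finset.singleton_subset_iff.2 hm)))

lemma average_recursion (h : IsProfile 𝒮 w g) (hsm : PerfectlySmooth 𝒮) (hN : 1 ≤ N) (hM : 0 < M)
    (j : Fin K) (hne : (𝒮 j).Nonempty) (hcard : ∀ S ∈ 𝒮 j, S.card = N) :
    0 ≤ N * average g j - (w + average g (j + 1)) := by
  have h1 : 0 ≤ (𝒮 j).card * N * (N * average g j - (w + average g (j + 1))) := by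
    rw [← h.sum_losses hsm hM j hcard]
    exact Finset.sum_nonneg fun S _ => h.loss_nonneg j S
  have h2 : (0 : ℝ) < (𝒮 j).card * N := by
    have := Finset.card_pos.2 hne
    positivity
  exact nonneg_of_mul_nonneg_right h1 h2

/-- Unrolling the recursion for the averages, with its slack. -/
lemma sum_slack (hN : 1 ≤ N) (a : ℕ → ℝ) (w : ℝ) (n : ℕ) :
    ∑ j ∈ Finset.range n, 1 / (N : ℝ) ^ j * (N * a j - (w + a (j + 1)))
      = N * a 0 - w * (∑ i ∈ Finset.range n, 1 / (N : ℝ) ^ i) - N * a n / (N : ℝ) ^ n := by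
  have hN' : (N : ℝ) ≠ 0 := by positivity
  induction n with
  | zero => simp
  | succ n ih =>
    rw [Finset.sum_range_succ, ih, Finset.sum_range_succ, pow_succ]
    field_simp
    ring

lemma average_zero (h : IsProfile 𝒮 w g) (hM : 0 < M) : average g 0 = 1 := by
  have hM' : (M : ℝ) ≠ 0 := by exact_mod_cast hM.ne'
  simp [average, h.zero_singleton, hM']

lemma average_last (h : IsProfile 𝒮 w g) : average g K = 0 := by
  simp [average, h.last_singleton]

lemma sum_slack_eq (h : IsProfile 𝒮 w g) (hN : 1 ≤ N) (hM : 0 < M) :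
    ∑ j ∈ Finset.range K, 1 / (N : ℝ) ^ j * (N * average g j - (w + average g (j + 1)))
      = N - w * ∑ i ∈ Finset.range K, 1 / (N : ℝ) ^ i := by
  rw [sum_slack hN, h.average_zero hM, h.average_last]
  simp

lemma slack_nonneg (h : IsProfile 𝒮 w g) (hsm : PerfectlySmooth 𝒮) (hN : 1 ≤ N) (hM : 0 < M)
    (hne : ∀ k, (𝒮 k).Nonempty) (hcard : ∀ k, ∀ S ∈ 𝒮 k, S.card = N) :
    ∀ j ∈ Finset.range K, 0 ≤ 1 / (N : ℝ) ^ j * (N * average g j - (w + average g (j + 1))) := by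
  intro j hj
  have hj' := Finset.mem_range.1 hj
  exact mul_nonneg (by positivity)
    (h.average_recursion hsm hN hM ⟨j, hj'⟩ (hne _) (hcard _))

/-- The converse: the rate is at most `N (1 + 1/N + ⋯ + 1/N^(K-1))⁻¹`. -/
lemma rate_le (h : IsProfile 𝒮 w g) (hsm : PerfectlySmooth 𝒮) (hN : 1 ≤ N) (hK : 1 ≤ K) (hM : 0 < M)
    (hne : ∀ k, (𝒮 k).Nonempty) (hcard : ∀ k, ∀ S ∈ 𝒮 k, S.card = N) :
    w ≤ (N : ℝ) * (∑ i ∈ Finset.range K, 1 / (N : ℝ) ^ i)⁻¹ := by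
  have h1 := Finset.sum_nonneg (h.slack_nonneg hsm hN hM hne hcard)
  rw [h.sum_slack_eq hN hM] at h1
  have h2 : 0 < ∑ i ∈ Finset.range K, 1 / (N : ℝ) ^ i :=
    Finset.sum_pos (fun i _ => by positivity) ⟨0, Finset.mem_range.2 hK⟩
  rw [← div_eq_mul_inv, le_div_iff₀ h2]
  linarith

/-- If the rate is maximal, neither kind of loss occurs: the averages satisfy the recursion with
equality, the symbols of a decoding set of `W_j` are independent given the first `j` source symbols,
and each of them determines the others if `W_j` is given as well. -/
lemma no_losses (h : IsProfile 𝒮 w g) (hsm : PerfectlySmooth 𝒮) (hN : 1 ≤ N) (hM : 0 < M)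
    (hne : ∀ k, (𝒮 k).Nonempty) (hcard : ∀ k, ∀ S ∈ 𝒮 k, S.card = N)
    (hw : w * ∑ i ∈ Finset.range K, 1 / (N : ℝ) ^ i = N) (j : Fin K) :
    N * average g j = w + average g (j + 1) ∧ ∀ S ∈ 𝒮 j,
      g j S = ∑ m ∈ S, g j {m} ∧ ∀ m ∈ S, g (j + 1) {m} = g (j + 1) S := by
  have h1 := h.sum_slack_eq hN hM
  rw [hw, sub_self, Finset.sum_eq_zero_iff_of_nonneg (h.slack_nonneg hsm hN hM hne hcard)] at h1
  have h2 : N * average g j - (w + average g (j + 1)) = 0 :=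
    (mul_eq_zero.1 (h1 j (Finset.mem_range.2 j.2))).resolve_left (by positivity)
  have h3 := h.sum_losses hsm hM j (hcard j)
  rw [h2, mul_zero, Finset.sum_eq_zero_iff_of_nonneg fun S _ => h.loss_nonneg j S] at h3
  refine ⟨sub_eq_zero.1 h2, fun S hS => ?_⟩
  have hsing : ∀ m ∈ S, 0 ≤ g (j + 1) S - g (j + 1) {m} := fun m hm =>
    sub_nonneg.2 (h.mono _ _ _ (Finset.singleton_subset_iff.2 hm))
  have hN' : (0 : ℝ) < N := by exact_mod_cast hN
  have hle := h.le_sum j S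
  have h4 := (add_eq_zero_iff_of_nonneg
    (mul_nonneg hN'.le (sub_nonneg.2 hle)) (Finset.sum_nonneg hsing)).1 (h3 S hS)
  refine ⟨?_, fun m hm => ?_⟩
  · have := (mul_eq_zero.1 h4.1).resolve_left hN'.ne'
    linarith
  · have := (Finset.sum_eq_zero_iff_of_nonneg hsing).1 h4.2 m hm
    linarith

/-- At maximal rate, given the first `j` source symbols every coded symbol has the same conditional
entropy. -/
lemma singleton_eq_average (h : IsProfile 𝒮 w g) (hsm : PerfectlySmooth 𝒮) (hN : 1 ≤ N) (hM : 0 < M)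
    (hne : ∀ k, (𝒮 k).Nonempty) (hcard : ∀ k, ∀ S ∈ 𝒮 k, S.card = N)
    (hw : w * ∑ i ∈ Finset.range K, 1 / (N : ℝ) ^ i = N) (j : ℕ) (hj : j ≤ K) (m : Fin M) :
    g j {m} = average g j := by
  induction j generalizing m with
  | zero => rw [h.zero_singleton, h.average_zero hM]
  | succ j ih =>
    have hjK : j < K := hj
    obtain ⟨S, hS, hmS⟩ := hsm.exists_mem hN ⟨j, hjK⟩ (hne _) (hcard _) m
    obtain ⟨hrec, hloss⟩ := h.no_losses hsm hN hM hne hcard hw ⟨j, hjK⟩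
    obtain ⟨hind, hdet⟩ := hloss S hS
    have hdec := h.decode ⟨j, hjK⟩ S hS
    simp only at hrec hind hdet hdec
    rw [Finset.sum_congr rfl fun x _ => ih hjK.le x, Finset.sum_const, nsmul_eq_mul,
      hcard _ S hS] at hind
    rw [hdet m hmS]
    linarith

/-- At maximal rate the code has length at least `N ^ K`. Call two coded symbols equivalent at level
`j` if they determine each other given the first `j` source symbols. A class at level `j + 1`
contains a decoding set of `W_j`, whose `N` members lie in distinct classes at level `j`; so a class
at level `j` has at least `N ^ j` members. -/
lemma pow_le_length (h : IsProfile 𝒮 w g) (hsm : PerfectlySmooth 𝒮) (hN : 1 ≤ N) (hM : 0 < M)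
    (hne : ∀ k, (𝒮 k).Nonempty) (hcard : ∀ k, ∀ S ∈ 𝒮 k, S.card = N)
    (hw : w * ∑ i ∈ Finset.range K, 1 / (N : ℝ) ^ i = N) : N ^ K ≤ M := by
  have hN' : (0 : ℝ) < N := by exact_mod_cast hN
  have hw0 : 0 < w := by
    have h2 : 0 ≤ ∑ i ∈ Finset.range K, 1 / (N : ℝ) ^ i :=
      Finset.sum_nonneg fun i _ => by positivity
    by_contra hle
    have := mul_nonpos_of_nonpos_of_nonneg (not_lt.1 hle) h2
    linarith
  have hsingle := h.singleton_eq_average hsm hN hM hne hcard hw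
  have classes : ∀ j, j ≤ K → ∀ m : Fin M,
      N ^ j ≤ (Finset.univ.filter fun x => g j {m, x} ≤ average g j).card := by
    intro j
    induction j with
    | zero =>
      intro _ m
      exact Finset.card_pos.2 ⟨m, by simp [hsingle 0 (Nat.zero_le K)]⟩
    | succ j ih =>
      intro hj m
      have hjK : j < K := hj
      obtain ⟨S, hS, hmS⟩ := hsm.exists_mem hN ⟨j, hjK⟩ (hne _) (hcard _) m
      obtain ⟨hrec, hloss⟩ := h.no_losses hsm hN hM hne hcard hw ⟨j, hjK⟩
      obtain ⟨hind, hdet⟩ := hloss S hS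
      simp only at hrec hind hdet
      have hpos : 0 < average g j := by
        have := h.average_nonneg (j + 1)
        by_contra hle
        have := mul_nonpos_of_nonneg_of_nonpos hN'.le (not_lt.1 hle)
        linarith
      have hdisj : (S : Set (Fin M)).PairwiseDisjoint
          fun s => Finset.univ.filter fun x => g j {s, x} ≤ average g j := by
        intro s hs t ht hst
        rw [Function.onFun, Finset.disjoint_left]
        intro x hxs hxt
        have hxs' := (Finset.mem_filter.1 hxs).2
        have hxt' := (Finset.mem_filter.1 hxt).2
        rw [Finset.pair_comm] at hxt'
        have hle := h.pair_trans (hsingle j hjK.le) hxs' hxt'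
        have hsub : ({s, t} : Finset (Fin M)) ⊆ S := by
          intro y hy
          rcases Finset.mem_insert.1 hy with rfl | hy
          · exact hs
          · rw [Finset.mem_singleton.1 hy]; exact ht
        have h1 := h.le_add_sum j {s, t} (S \ {s, t})
        rw [Finset.union_sdiff_of_subset hsub, hind, ← Finset.sum_sdiff hsub,
          Finset.sum_pair hst, hsingle j hjK.le, hsingle j hjK.le] at h1
        linarith
      calc N ^ (j + 1) = ∑ _s ∈ S, N ^ j := by
            rw [Finset.sum_const, hcard _ S hS, smul_eq_mul, pow_succ, mul_comm]
        _ ≤ ∑ s ∈ S, (Finset.univ.filter fun x => g j {s, x} ≤ average g j).card :=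
            Finset.sum_le_sum fun s _ => ih hjK.le s
        _ = (S.biUnion fun s => Finset.univ.filter fun x => g j {s, x} ≤ average g j).card :=
            (Finset.card_biUnion hdisj).symm
        _ ≤ _ := by
            refine Finset.card_le_card fun x hx => ?_
            obtain ⟨s, hs, hx⟩ := Finset.mem_biUnion.1 hx
            have hsx := (Finset.mem_filter.1 hx).2
            refine Finset.mem_filter.2 ⟨Finset.mem_univ x, ?_⟩
            refine h.pair_trans (hsingle (j + 1) hj) (y := s) ?_ ?_
            · rw [← hsingle (j + 1) hj m, hdet m hmS]
              refine h.mono _ _ _ fun y hy => ?_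
              rcases Finset.mem_insert.1 hy with rfl | hy
              · exact hmS
              · rw [Finset.mem_singleton.1 hy]; exact hs
            · have h1 := h.conditioning j {s} {s, x} (by simp)
              rw [hsingle j hjK.le, hsingle (j + 1) hj] at h1
              linarith
  calc N ^ K ≤ _ := classes K le_rfl ⟨0, hM⟩
    _ ≤ _ := Finset.card_le_univ _
    _ = M := Fintype.card_fin M

end IsProfile

/-! ### Compactness -/

/-- Rates of profiles of a fixed length form a closed set, so that a supremum of rates of codes of
that length is the rate of a profile, if not of a code. -/
lemma isClosed_profileRates {K M : ℕ} (𝒮 : Fin K → Finset (Finset (Fin M))) :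
    IsClosed {w | ∃ g, IsProfile 𝒮 w g} := by
  -- A cube contains all `g`, hence projecting the closed set of pairs `(w, g)` is harmless.
  let C : Set (ℕ → Finset (Fin M) → ℝ) :=
    Set.univ.pi fun _ => Set.univ.pi fun _ => Set.Icc (0 : ℝ) M
  have hC : IsCompact C := isCompact_univ_pi fun _ => isCompact_univ_pi fun _ => isCompact_Icc
  have hclosed : IsClosed {q : ℝ × (ℕ → Finset (Fin M) → ℝ) | IsProfile 𝒮 q.1 q.2} := by
    have e : {q : ℝ × (ℕ → Finset (Fin M) → ℝ) | IsProfile 𝒮 q.1 q.2} =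
        {q | (∀ j, q.2 j ∅ = 0) ∧ (∀ j S T, S ⊆ T → q.2 j S ≤ q.2 j T) ∧
          (∀ j S T, q.2 j (S ∪ T) + q.2 j (S ∩ T) ≤ q.2 j S + q.2 j T) ∧
          (∀ j S T, S ⊆ T → q.2 (j + 1) T + q.2 j S ≤ q.2 j T + q.2 (j + 1) S) ∧
          (∀ m, q.2 0 {m} = 1) ∧ (∀ m, q.2 K {m} = 0) ∧
          ∀ (j : Fin K), ∀ S ∈ 𝒮 j, q.2 j S = q.1 + q.2 (j + 1) S} := by
      ext q
      exact ⟨fun h => ⟨h.1, h.2, h.3, h.4, h.5, h.6, h.7⟩,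
        fun ⟨h1, h2, h3, h4, h5, h6, h7⟩ => ⟨h1, h2, h3, h4, h5, h6, h7⟩⟩
    rw [e]
    simp only [Set.ofPred_and, Set.ofPred_forall]
    refine IsClosed.inter ?_ (IsClosed.inter ?_ (IsClosed.inter ?_ (IsClosed.inter ?_
      (IsClosed.inter ?_ (IsClosed.inter ?_ ?_))))) <;>
    repeat' first
      | refine isClosed_iInter fun _ => ?_
      | exact isClosed_eq (by fun_prop) (by fun_prop)
      | exact isClosed_le (by fun_prop) (by fun_prop)
  have hproj : {w | ∃ g, IsProfile 𝒮 w g}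
      = Prod.fst '' {q : ℝ × C | IsProfile 𝒮 q.1 q.2} := by
    ext w
    constructor
    · rintro ⟨g, h⟩
      exact ⟨(w, ⟨g, fun j _ S _ => ⟨h.nonneg j S, h.le_length j S⟩⟩), h, rfl⟩
    · rintro ⟨⟨w, g⟩, h, rfl⟩
      exact ⟨g, h⟩
  have : CompactSpace C := isCompact_iff_compactSpace.1 hC
  rw [hproj]
  exact isClosedMap_fst_of_compactSpace _
    (hclosed.preimage (continuous_fst.prodMk (continuous_subtype_val.comp continuous_snd)))

/-! ### From codes to profiles -/

section Law

variable {Ω A : Type} [MeasurableSpace Ω] {K : ℕ} {P : Measure Ω} {W : Fin K → Ω → A}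

/-- The joint law of the source symbols, as weights on the tuples of their values. -/
noncomputable def sourceLaw (P : Measure Ω) (W : Fin K → Ω → A) (v : Fin K → A) : ℝ :=
  P.real {ω | (fun k => W k ω) = v}

lemma sourceLaw_nonneg (v : Fin K → A) : 0 ≤ sourceLaw P W v := measureReal_nonneg

variable [Fintype A]

open Classical in
lemma measureReal_eq_sum_sourceLaw [IsFiniteMeasure P]
    (hW : ∀ k a, MeasurableSet {ω | W k ω = a}) (E : Set (Fin K → A)) :
    P.real {ω | (fun k => W k ω) ∈ E} = ∑ v, if v ∈ E then sourceLaw P W v else 0 := by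
  have hmeas : ∀ v : Fin K → A, MeasurableSet {ω | (fun k => W k ω) = v} := by
    intro v
    have : {ω | (fun k => W k ω) = v} = ⋂ k, {ω | W k ω = v k} := by
      ext ω
      simp [funext_iff]
    rw [this]
    exact MeasurableSet.iInter fun k => hW k (v k)
  have hunion : {ω | (fun k => W k ω) ∈ E}
      = ⋃ v ∈ Finset.univ.filter (· ∈ E), {ω | (fun k => W k ω) = v} := by
    ext ω
    simp
  rw [hunion, measureReal_biUnion_finset _ fun v _ => hmeas v, Finset.sum_filter]
  · rfl
  · intro u _ v _ huv
    rw [Function.onFun, Set.disjoint_left]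
    intro ω hu hv
    exact huv (Eq.trans (Eq.symm hu) hv)

lemma sum_sourceLaw [IsProbabilityMeasure P] (hW : ∀ k a, MeasurableSet {ω | W k ω = a}) :
    ∑ v, sourceLaw P W v = 1 := by
  have h := measureReal_eq_sum_sourceLaw (P := P) hW Set.univ
  simpa using h.symm

lemma blockMass_ker [IsFiniteMeasure P] (hW : ∀ k a, MeasurableSet {ω | W k ω = a}) {β : Type*}
    (F : (Fin K → A) → β) (v : Fin K → A) :
    blockMass (sourceLaw P W) (Setoid.ker F) v = P.real {ω | F (fun k => W k ω) = F v} := by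
  classical
  refine Eq.trans ?_ (measureReal_eq_sum_sourceLaw (P := P) hW {u | F u = F v}).symm
  exact Finset.sum_congr rfl fun u _ => if_congr Iff.rfl rfl rfl

/-- The law of the unconscious statistician. -/
lemma sum_measureReal_mul [IsFiniteMeasure P] (hW : ∀ k a, MeasurableSet {ω | W k ω = a})
    {β : Type*} [Fintype β] (F : (Fin K → A) → β) (f : β → ℝ) :
    ∑ y, P.real {ω | F (fun k => W k ω) = y} * f y = ∑ v, sourceLaw P W v * f (F v) := by
  classical
  have : ∀ y, P.real {ω | F (fun k => W k ω) = y} * f y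
      = ∑ v, if F v = y then sourceLaw P W v * f (F v) else 0 := by
    intro y
    have h := measureReal_eq_sum_sourceLaw (P := P) hW {u | F u = y}
    simp only [Set.mem_ofPred_eq] at h
    rw [h, Finset.sum_mul]
    refine Finset.sum_congr rfl fun v _ => ?_
    by_cases hv : F v = y <;> simp [hv]
  rw [Finset.sum_congr rfl fun y _ => this y, Finset.sum_comm]
  simp

lemma entropy_eq_partitionEntropy [IsFiniteMeasure P] (hW : ∀ k a, MeasurableSet {ω | W k ω = a})
    {β : Type} [Fintype β] (F : (Fin K → A) → β) :
    entropy P (fun ω => F fun k => W k ω)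
      = partitionEntropy (sourceLaw P W) (Setoid.ker F) := by
  rw [entropy, sum_measureReal_mul hW F fun y =>
    Real.logb 2 (P.real {ω | F (fun k => W k ω) = y}), partitionEntropy]
  simp only [blockMass_ker hW]

lemma condEntropy_eq_partitionEntropy [IsFiniteMeasure P]
    (hW : ∀ k a, MeasurableSet {ω | W k ω = a})
    {β γ : Type} [Fintype β] [Fintype γ] (F : (Fin K → A) → β) (G : (Fin K → A) → γ) :
    condEntropy P (fun ω => F fun k => W k ω) (fun ω => G fun k => W k ω)
      = partitionEntropy (sourceLaw P W) (Setoid.ker F ⊓ Setoid.ker G)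
        - partitionEntropy (sourceLaw P W) (Setoid.ker G) := by
  have hker : Setoid.ker F ⊓ Setoid.ker G = Setoid.ker fun v => (F v, G v) := by
    ext u v
    simp [Setoid.ker_def, Setoid.inf_def]
  have h := sum_measureReal_mul (P := P) hW (fun v => (F v, G v)) fun q =>
    Real.logb 2 (P.real {ω | F (fun k => W k ω) = q.1 ∧ G (fun k => W k ω) = q.2} /
      P.real {ω | G (fun k => W k ω) = q.2})
  simp only [Fintype.sum_prod_type_right, Prod.ext_iff] at h
  rw [condEntropy, h, partitionEntropy, partitionEntropy, sub_neg_eq_add, neg_add_eq_sub,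
    ← Finset.sum_sub_distrib, ← Finset.sum_neg_distrib]
  refine Finset.sum_congr rfl fun v _ => ?_
  rw [hker]
  rcases (sourceLaw_nonneg (P := P) (W := W) v).eq_or_lt with h0 | h0
  · simp [← h0]
  · have q : ∀ r, 0 < blockMass (sourceLaw P W) r v := fun r =>
      h0.trans_le (le_blockMass sourceLaw_nonneg r v)
    have e1 := q (Setoid.ker fun v => (F v, G v))
    have e2 := q (Setoid.ker G)
    rw [blockMass_ker hW] at e1 e2
    rw [blockMass_ker hW, blockMass_ker hW]
    simp only [Prod.mk.injEq] at e1 ⊢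
    rw [Real.logb_div e1.ne' e2.ne']
    ring

end Law

/-- The partition of the tuples of source values by the first `j` source symbols and the coded
symbols in `S`. -/
def codeSetoid {A B : Type} {K M : ℕ} (enc : (Fin K → A) → Fin M → B) (j : ℕ)
    (S : Finset (Fin M)) : Setoid (Fin K → A) where
  r u v := (∀ i : Fin K, (i : ℕ) < j → u i = v i) ∧ ∀ m ∈ S, enc u m = enc v m
  iseqv :=
    { refl := fun _ => ⟨fun _ _ => rfl, fun _ _ => rfl⟩
      symm := fun h => ⟨fun i hi => (h.1 i hi).symm, fun m hm => (h.2 m hm).symm⟩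
      trans := fun h h' => ⟨fun i hi => (h.1 i hi).trans (h'.1 i hi),
        fun m hm => (h.2 m hm).trans (h'.2 m hm)⟩ }

section CodeSetoid

variable {A B : Type} {K M : ℕ} {enc : (Fin K → A) → Fin M → B}

lemma codeSetoid_apply {j : ℕ} {S : Finset (Fin M)} {u v : Fin K → A} :
    codeSetoid enc j S u v ↔
      (∀ i : Fin K, (i : ℕ) < j → u i = v i) ∧ ∀ m ∈ S, enc u m = enc v m :=
  Iff.rfl

lemma codeSetoid_anti {i j : ℕ} (hij : i ≤ j) {S T : Finset (Fin M)} (hST : S ⊆ T) :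
    codeSetoid enc j T ≤ codeSetoid enc i S :=
  fun _ _ h => ⟨fun k hk => h.1 k (hk.trans_le hij), fun m hm => h.2 m (hST hm)⟩

lemma codeSetoid_union (j : ℕ) (S T : Finset (Fin M)) :
    codeSetoid enc j (S ∪ T) = codeSetoid enc j S ⊓ codeSetoid enc j T := by
  refine le_antisymm (le_inf (codeSetoid_anti le_rfl Finset.subset_union_left)
    (codeSetoid_anti le_rfl Finset.subset_union_right)) ?_
  intro u v h
  exact ⟨h.1.1, fun m hm => (Finset.mem_union.1 hm).elim (h.1.2 m) (h.2.2 m)⟩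

lemma codeSetoid_succ (j : Fin K) (S : Finset (Fin M)) :
    codeSetoid enc (j + 1) S = Setoid.ker (fun v => v j) ⊓ codeSetoid enc j S := by
  ext u v
  constructor
  · intro h
    exact ⟨h.1 j (Nat.lt_succ_self _), codeSetoid_anti (Nat.le_succ _) subset_rfl h⟩
  · rintro ⟨h1, h2⟩
    refine ⟨fun i hi => ?_, h2.2⟩
    rcases (Nat.lt_succ_iff.1 hi).lt_or_eq with hi | hi
    · exact h2.1 i hi
    · rw [Fin.ext hi]
      exact h1

lemma codeSetoid_conditioning (j : ℕ) {S T : Finset (Fin M)} (h : S ⊆ T) :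
    codeSetoid enc (j + 1) T = codeSetoid enc j T ⊓ codeSetoid enc (j + 1) S :=
  le_antisymm (le_inf (codeSetoid_anti (Nat.le_succ j) subset_rfl) (codeSetoid_anti le_rfl h))
    fun _ _ hr => ⟨hr.2.1, hr.1.2⟩

lemma codeSetoid_zero_empty : codeSetoid enc 0 ∅ = ⊤ := by
  ext u v
  simp [codeSetoid_apply]

lemma codeSetoid_last (S : Finset (Fin M)) : codeSetoid enc K S = ⊥ := by
  ext u v
  refine ⟨fun h => funext fun i => h.1 i i.2, fun h => ?_⟩
  have h : u = v := h
  rw [h]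

end CodeSetoid

section Bridge

variable {Ω A B : Type} [MeasurableSpace Ω] [Fintype A] {K M N : ℕ} {P : Measure Ω}
  {W : Fin K → Ω → A} {enc : (Fin K → A) → Fin M → B} {𝒮 : Fin K → Finset (Finset (Fin M))}
  {Lw Lx : ℝ}

/-- `H(W_0, …, W_(j-1), X_S)`. -/
noncomputable def jointEntropy (P : Measure Ω) (W : Fin K → Ω → A)
    (enc : (Fin K → A) → Fin M → B) (j : ℕ) (S : Finset (Fin M)) : ℝ :=
  partitionEntropy (sourceLaw P W) (codeSetoid enc j S)

lemma jointEntropy_mono {i j : ℕ} (hij : i ≤ j) {S T : Finset (Fin M)} (hST : S ⊆ T) :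
    jointEntropy P W enc i S ≤ jointEntropy P W enc j T :=
  partitionEntropy_anti sourceLaw_nonneg (codeSetoid_anti hij hST)

lemma jointEntropy_submodular (j : ℕ) (S T : Finset (Fin M)) :
    jointEntropy P W enc j (S ∪ T) + jointEntropy P W enc j (S ∩ T)
      ≤ jointEntropy P W enc j S + jointEntropy P W enc j T := by
  rw [jointEntropy, codeSetoid_union]
  exact partitionEntropy_submodular sourceLaw_nonneg
    (codeSetoid_anti le_rfl Finset.inter_subset_left)
    (codeSetoid_anti le_rfl Finset.inter_subset_right)

lemma jointEntropy_conditioning (j : ℕ) {S T : Finset (Fin M)} (h : S ⊆ T) :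
    jointEntropy P W enc (j + 1) T + jointEntropy P W enc j S
      ≤ jointEntropy P W enc j T + jointEntropy P W enc (j + 1) S := by
  rw [jointEntropy, codeSetoid_conditioning j h]
  exact partitionEntropy_submodular sourceLaw_nonneg
    (codeSetoid_anti le_rfl h) (codeSetoid_anti (Nat.le_succ j) subset_rfl)

lemma jointEntropy_last (S : Finset (Fin M)) :
    jointEntropy P W enc K S = jointEntropy P W enc K ∅ := by
  rw [jointEntropy, jointEntropy, codeSetoid_last, codeSetoid_last]

variable [Fintype B]

namespace IsLDC

lemma partitionEntropy_source (h : IsLDC N P W enc 𝒮 Lw Lx) (k : Fin K) :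
    partitionEntropy (sourceLaw P W) (Setoid.ker fun v => v k) = Lw := by
  have := h.isProbabilityMeasure
  rw [← h.entropy_source k]
  exact (entropy_eq_partitionEntropy h.measurableSet_source fun v => v k).symm

lemma jointEntropy_zero_empty (h : IsLDC N P W enc 𝒮 Lw Lx) :
    jointEntropy P W enc 0 ∅ = 0 := by
  have := h.isProbabilityMeasure
  rw [jointEntropy, codeSetoid_zero_empty,
    partitionEntropy_top (sum_sourceLaw h.measurableSet_source)]

lemma jointEntropy_succ_le (h : IsLDC N P W enc 𝒮 Lw Lx) (j : Fin K) :
    jointEntropy P W enc (j + 1) ∅ ≤ Lw + jointEntropy P W enc j ∅ := by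
  have := h.isProbabilityMeasure
  have h1 := partitionEntropy_submodular (p := sourceLaw P W) sourceLaw_nonneg
    (r := Setoid.ker fun v : Fin K → A => v j) (s := codeSetoid enc j ∅) le_top le_top
  rw [← codeSetoid_succ, h.partitionEntropy_source,
    partitionEntropy_top (sum_sourceLaw h.measurableSet_source), add_zero] at h1
  exact h1

/-- The chain rule for the independent source symbols. -/
lemma jointEntropy_empty (h : IsLDC N P W enc 𝒮 Lw Lx) (j : ℕ) (hj : j ≤ K) :
    jointEntropy P W enc j ∅ = j * Lw := by
  have := h.isProbabilityMeasure
  have htotal : jointEntropy P W enc K ∅ = K * Lw := by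
    have h1 := h.entropy_sources
    rw [entropy_eq_partitionEntropy h.measurableSet_source fun v => v,
      Finset.sum_congr rfl fun k _ => h.entropy_source k] at h1
    have h2 : Setoid.ker (fun v : Fin K → A => v) = codeSetoid enc K ∅ := by
      rw [codeSetoid_last]
      rfl
    rw [jointEntropy, ← h2, h1]
    simp
  -- Subadditivity bounds the increments by `Lw`, and the total is `K * Lw`.
  have hupper : ∀ j, j ≤ K → jointEntropy P W enc j ∅ ≤ j * Lw := by
    intro j
    induction j with
    | zero => intro _; simp [h.jointEntropy_zero_empty]
    | succ j ih =>
      intro hj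
      have h1 := h.jointEntropy_succ_le ⟨j, hj⟩
      have h2 := ih (Nat.le_of_succ_le hj)
      push_cast
      simp only at h1
      linarith
  refine le_antisymm (hupper j hj) ?_
  induction hj using Nat.decreasingInduction with
  | self => exact htotal.ge
  | of_succ i hi ih =>
    have h1 := h.jointEntropy_succ_le ⟨i, hi⟩
    push_cast at ih
    simp only at h1
    linarith

lemma jointEntropy_decode (h : IsLDC N P W enc 𝒮 Lw Lx) (j : Fin K) {S : Finset (Fin M)}
    (hS : S ∈ 𝒮 j) : jointEntropy P W enc (j + 1) S = jointEntropy P W enc j S := by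
  have := h.isProbabilityMeasure
  refine le_antisymm ?_ (jointEntropy_mono (Nat.le_succ _) subset_rfl)
  have h0 := (condEntropy_eq_partitionEntropy (P := P) h.measurableSet_source (fun v => v j)
    (fun v (m : {m // m ∈ S}) => enc v m)).symm.trans (h.decodable j S hS)
  set r : Setoid (Fin K → A) := Setoid.ker fun v (m : {m // m ∈ S}) => enc v m with hr
  have hle : codeSetoid enc j S ≤ r := fun u v huv => funext fun m => huv.2 m m.2
  have hinf : (Setoid.ker (fun v : Fin K → A => v j) ⊓ r) ⊓ codeSetoid enc j S
      = codeSetoid enc (j + 1) S := by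
    rw [codeSetoid_succ, inf_assoc, inf_eq_right.2 hle]
  have h1 := partitionEntropy_submodular (p := sourceLaw P W) sourceLaw_nonneg
    (r := Setoid.ker (fun v : Fin K → A => v j) ⊓ r) (t := r) inf_le_right hle
  rw [hinf] at h1
  rw [jointEntropy, jointEntropy]
  linarith

lemma isProfile (h : IsLDC N P W enc 𝒮 Lw Lx) (hLx : 0 < Lx) :
    IsProfile 𝒮 (Lw / Lx) fun j S =>
      (jointEntropy P W enc j S - jointEntropy P W enc j ∅) / Lx where
  empty j := by simp
  mono j S T hST := by
    have := jointEntropy_mono (P := P) (W := W) (enc := enc) (le_refl j) hST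
    gcongr
  submodular j S T := by
    rw [← add_div, ← add_div]
    have := jointEntropy_submodular (P := P) (W := W) (enc := enc) j S T
    exact div_le_div_of_nonneg_right (by linarith) hLx.le
  conditioning j S T hST := by
    rw [← add_div, ← add_div]
    have := jointEntropy_conditioning (P := P) (W := W) (enc := enc) j hST
    exact div_le_div_of_nonneg_right (by linarith) hLx.le
  zero_singleton m := by
    have := h.isProbabilityMeasure
    have h1 := h.entropy_coded m
    rw [show codedSymbol W enc m = fun ω => (fun v => enc v m) fun k => W k ω from rfl,
      entropy_eq_partitionEntropy h.measurableSet_source fun v => enc v m] at h1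
    have h2 : Setoid.ker (fun v => enc v m) = codeSetoid enc 0 {m} := by
      ext u v
      simp [codeSetoid_apply, Setoid.ker_def]
    rw [h.jointEntropy_zero_empty, jointEntropy, ← h2, h1, sub_zero, div_self hLx.ne']
  last_singleton m := by rw [jointEntropy_last, sub_self, zero_div]
  decode j S hS := by
    rw [← add_div, h.jointEntropy_decode j hS, h.jointEntropy_empty j j.2.le,
      h.jointEntropy_empty (j + 1) j.2]
    push_cast
    ring

end IsLDC

end Bridge

/-! ### Codes of maximal rate -/

lemma condEntropy_eq_zero {Ω β γ : Type} [MeasurableSpace Ω] [Fintype β] [Fintype γ]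
    (P : Measure Ω) {Y : Ω → β} {Z : Ω → γ} (h : ∀ ω ω', Z ω = Z ω' → Y ω = Y ω') :
    condEntropy P Y Z = 0 := by
  rw [condEntropy, neg_eq_zero]
  refine Finset.sum_eq_zero fun z _ => Finset.sum_eq_zero fun y _ => ?_
  by_cases hne : ∃ ω, Y ω = y ∧ Z ω = z
  · obtain ⟨ω₀, hy, hz⟩ := hne
    have e : {ω | Y ω = y ∧ Z ω = z} = {ω | Z ω = z} := by
      ext ω
      exact ⟨fun hω => hω.2, fun hω => ⟨(h ω ω₀ (Eq.trans hω hz.symm)).trans hy, hω⟩⟩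
    rw [e]
    rcases eq_or_ne (P.real {ω | Z ω = z}) 0 with h0 | h0
    · rw [h0, zero_mul]
    · rw [div_self h0, Real.logb_one, mul_zero]
  · have e : {ω | Y ω = y ∧ Z ω = z} = ∅ := by
      ext ω
      exact ⟨fun hω => hne ⟨ω, hω⟩, fun hω => hω.elim⟩
    rw [e, measureReal_empty, zero_mul]

/-- A homomorphism from a finite group with the uniform distribution is uniformly distributed on its
range `R`. -/
lemma entropy_uniformOn_hom {G H : Type} [AddGroup G] [Fintype G] [MeasurableSpace G]
    [MeasurableSingletonClass G] [AddGroup H] [Fintype H] (φ : G →+ H) (R : Finset H)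
    (hR : ∀ y, y ∈ R ↔ ∃ x, φ x = y) :
    entropy (ProbabilityTheory.uniformOn (Set.univ : Set G)) φ = Real.logb 2 R.card := by
  classical
  have hreal : ∀ y, (ProbabilityTheory.uniformOn (Set.univ : Set G)).real {x | φ x = y}
      = ((Finset.univ.filter fun x => φ x = y).card : ℝ) / Fintype.card G := by
    intro y
    rw [Measure.real, ProbabilityTheory.uniformOn_univ,
      show {x | φ x = y} = ((Finset.univ.filter fun x => φ x = y : Finset G) : Set G) by ext; simp,
      Measure.count_apply_finset]
    simp
  have hG : (0 : ℝ) < Fintype.card G := by exact_mod_cast Fintype.card_pos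
  have h0R : (0 : H) ∈ R := (hR 0).2 ⟨0, map_zero φ⟩
  have hRpos : (0 : ℝ) < R.card := by exact_mod_cast Finset.card_pos.2 ⟨0, h0R⟩
  set c := (Finset.univ.filter fun x => φ x = 0).card with hc
  have hfib : ∀ y ∈ R, (Finset.univ.filter fun x => φ x = y).card = c := fun y hy =>
    AddMonoidHom.card_fiber_eq_of_mem_range φ ((hR y).1 hy) ⟨0, map_zero φ⟩
  have hcount : Fintype.card G = R.card * c := by
    rw [← Finset.card_univ, Finset.card_eq_sum_card_fiberwise (f := φ) (t := R)
      fun x _ => (hR _).2 ⟨x, rfl⟩, Finset.sum_congr rfl hfib, Finset.sum_const, smul_eq_mul]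
  have hval : ∀ y ∈ R, (ProbabilityTheory.uniformOn (Set.univ : Set G)).real {x | φ x = y}
      = (R.card : ℝ)⁻¹ := by
    intro y hy
    rw [hreal, hfib y hy, hcount]
    rw [hcount] at hG
    push_cast at hG ⊢
    have : (c : ℝ) ≠ 0 := fun h => by simp [h] at hG
    field_simp
  have hzero : ∀ y, y ∉ R →
      (ProbabilityTheory.uniformOn (Set.univ : Set G)).real {x | φ x = y} = 0 := by
    intro y hy
    rw [hreal, Finset.card_eq_zero.2, Nat.cast_zero, zero_div]
    exact Finset.filter_eq_empty_iff.2 fun x _ hx => hy ((hR y).2 ⟨x, hx⟩)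
  rw [entropy, ← Finset.sum_subset (Finset.subset_univ R) fun y _ hy => by
    rw [hzero y hy, zero_mul], Finset.sum_congr rfl fun y hy => by rw [hval y hy],
    Finset.sum_const, nsmul_eq_mul, Real.logb_inv]
  field_simp

/-- The coded symbol at the point `m` of the grid `{0, …, n} ^ K`: its component at `t` is the sum
over `j` of the entry `m j` of `v j t`, where an entry zero is inserted at position `t j`. The
component at `t = m` vanishes and the others are uniform bits, so that all the coded symbols have
the same entropy. -/
def gridSymbol {n K : ℕ} (m : Fin K → Fin (n + 1)) :
    (Fin K → (Fin K → Fin (n + 1)) → Fin n → ZMod 2) →+ ((Fin K → Fin (n + 1)) → ZMod 2) where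
  toFun v t := ∑ j, (t j).insertNth (α := fun _ => ZMod 2) 0 (v j t) (m j)
  map_zero' := by
    funext t
    refine Finset.sum_eq_zero fun j _ => ?_
    rcases Fin.eq_self_or_eq_succAbove (t j) (m j) with h | ⟨i, h⟩
    · rw [h, Fin.insertNth_apply_same]
    · rw [h, Fin.insertNth_apply_succAbove]
      rfl
  map_add' u v := by
    funext t
    simp only [Pi.add_apply, ← Finset.sum_add_distrib]
    refine Finset.sum_congr rfl fun j _ => ?_
    rcases Fin.eq_self_or_eq_succAbove (t j) (m j) with h | ⟨i, h⟩
    · rw [h]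
      simp only [Fin.insertNth_apply_same, add_zero]
    · rw [h]
      simp only [Fin.insertNth_apply_succAbove, Pi.add_apply]

lemma gridSymbol_apply {n K : ℕ} (m : Fin K → Fin (n + 1))
    (v : Fin K → (Fin K → Fin (n + 1)) → Fin n → ZMod 2) (t : Fin K → Fin (n + 1)) :
    gridSymbol m v t = ∑ j, (t j).insertNth (α := fun _ => ZMod 2) 0 (v j t) (m j) := rfl

lemma gridSymbol_range {n K : ℕ} (m : Fin K → Fin (n + 1)) (y : (Fin K → Fin (n + 1)) → ZMod 2) :
    (∃ v, gridSymbol m v = y) ↔ y m = 0 := by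
  constructor
  · rintro ⟨v, rfl⟩
    rw [gridSymbol_apply]
    exact Finset.sum_eq_zero fun j _ => Fin.insertNth_apply_same _ _ _
  · intro hy
    -- For each `t ≠ m`, one source symbol whose entry at `m` is not the inserted zero suffices.
    have : ∀ t, ∃ u : Fin K → Fin n → ZMod 2,
        ∑ j, (t j).insertNth (α := fun _ => ZMod 2) 0 (u j) (m j) = y t := by
      intro t
      by_cases ht : t = m
      · subst ht
        exact ⟨0, by simp [hy]⟩
      · obtain ⟨j₀, hj₀⟩ := Function.ne_iff.1 ht
        obtain ⟨i, hi⟩ := (Fin.eq_self_or_eq_succAbove (t j₀) (m j₀)).resolve_left (Ne.symm hj₀)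
        refine ⟨fun j _ => if j = j₀ then y t else 0, ?_⟩
        rw [Finset.sum_eq_single j₀]
        · rw [hi, Fin.insertNth_apply_succAbove]
          exact if_pos rfl
        · intro j _ hj
          rcases Fin.eq_self_or_eq_succAbove (t j) (m j) with h | ⟨i, h⟩
          · rw [h, Fin.insertNth_apply_same]
          · rw [h, Fin.insertNth_apply_succAbove]
            exact if_neg hj
        · exact fun h => absurd (Finset.mem_univ _) h
    choose u hu using this
    exact ⟨fun j t => u t j, funext hu⟩

/-- The coded symbols on a line of direction `k` determine the source symbol `k`: the point where
the inserted zero is read gives the contribution of the other source symbols. -/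
lemma gridSymbol_decode {n K : ℕ} (k : Fin K) (F : Fin K → Fin (n + 1))
    {u v : Fin K → (Fin K → Fin (n + 1)) → Fin n → ZMod 2}
    (h : ∀ i, gridSymbol (Function.update F k i) u = gridSymbol (Function.update F k i) v) :
    u k = v k := by
  have split : ∀ (x : Fin K → (Fin K → Fin (n + 1)) → Fin n → ZMod 2) t i,
      gridSymbol (Function.update F k i) x t
        = (t k).insertNth (α := fun _ => ZMod 2) 0 (x k t) i
          + ∑ j ∈ Finset.univ.erase k, (t j).insertNth (α := fun _ => ZMod 2) 0 (x j t) (F j) := by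
    intro x t i
    rw [gridSymbol_apply, ← Finset.add_sum_erase _ _ (Finset.mem_univ k), Function.update_self]
    congr 1
    refine Finset.sum_congr rfl fun j hj => ?_
    rw [Function.update_of_ne (Finset.ne_of_mem_erase hj)]
  funext t l
  have h0 := congrFun (h (t k)) t
  have h1 := congrFun (h ((t k).succAbove l)) t
  rw [split, split, Fin.insertNth_apply_same, Fin.insertNth_apply_same, zero_add, zero_add] at h0
  rw [split, split, Fin.insertNth_apply_succAbove, Fin.insertNth_apply_succAbove, h0] at h1
  exact add_right_cancel h1

lemma sum_one_div_pow_eq {N : ℕ} (hN : 2 ≤ N) (K : ℕ) :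
    ∑ i ∈ Finset.range K, 1 / (N : ℝ) ^ i
      = N * ((N : ℝ) ^ K - 1) / ((N - 1) * (N : ℝ) ^ K) := by
  have h2 : (2 : ℝ) ≤ N := by exact_mod_cast hN
  have h1 : (N : ℝ) - 1 ≠ 0 := by linarith
  have h0 : (N : ℝ) ≠ 0 := by linarith
  induction K with
  | zero => simp
  | succ K ih =>
    rw [Finset.sum_range_succ, ih, pow_succ]
    field_simp
    ring

section Grid

variable (n K M : ℕ) (e : (Fin K → Fin (n + 1)) ≃ Fin M)

/-- The lines of direction `k` in the grid. -/
def gridLines (k : Fin K) : Finset (Finset (Fin M)) :=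
  Finset.univ.image fun F : Fin K → Fin (n + 1) =>
    Finset.univ.image fun i => e (Function.update F k i)

variable {n K M e}

lemma mem_line_iff {k : Fin K} {F : Fin K → Fin (n + 1)} {m : Fin M} :
    (m ∈ Finset.univ.image fun i => e (Function.update F k i)) ↔
      ∀ j, j ≠ k → e.symm m j = F j := by
  simp only [Finset.mem_image, Finset.mem_univ, true_and]
  constructor
  · rintro ⟨i, rfl⟩ j hj
    rw [Equiv.symm_apply_apply, Function.update_of_ne hj]
  · intro h
    refine ⟨e.symm m k, ?_⟩
    rw [← Equiv.eq_symm_apply]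
    funext j
    by_cases hj : j = k
    · subst hj
      rw [Function.update_self]
    · rw [Function.update_of_ne hj, h j hj]

lemma gridLines_smooth : PerfectlySmooth (gridLines n K M e) := by
  -- Every point lies on exactly one line of each direction.
  have : ∀ (k : Fin K) (m : Fin M), ((gridLines n K M e k).filter fun S => m ∈ S).card = 1 := by
    intro k m
    rw [Finset.card_eq_one]
    refine ⟨Finset.univ.image fun i => e (Function.update (e.symm m) k i), ?_⟩
    ext S
    rw [Finset.mem_filter, Finset.mem_singleton]
    constructor
    · rintro ⟨hS, hm⟩
      obtain ⟨F, -, rfl⟩ := Finset.mem_image.1 hS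
      have hF := mem_line_iff.1 hm
      ext x
      rw [mem_line_iff, mem_line_iff]
      exact forall₂_congr fun j hj => by rw [hF j hj]
    · rintro rfl
      exact ⟨Finset.mem_image_of_mem _ (Finset.mem_univ _), mem_line_iff.2 fun _ _ => rfl⟩
  intro k m m'
  rw [this, this]

end Grid

/-- The grid code attains the maximal rate with length `N ^ K`, for `N ≥ 2`. -/
lemma grid_rate_mem (n K : ℕ) (hn : 1 ≤ n) (hK : 1 ≤ K) :
    ((n + 1 : ℕ) : ℝ) * (∑ i ∈ Finset.range K, 1 / ((n + 1 : ℕ) : ℝ) ^ i)⁻¹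
      ∈ smoothRates (n + 1) K ((n + 1) ^ K) := by
  let T := Fin K → Fin (n + 1)
  have hT : Fintype.card T = (n + 1) ^ K := by simp [T]
  let e : T ≃ Fin ((n + 1) ^ K) := Fintype.equivFinOfCardEq hT
  let _ : MeasurableSpace (Fin K → T → Fin n → ZMod 2) := ⊤
  have : DiscreteMeasurableSpace (Fin K → T → Fin n → ZMod 2) := ⟨fun _ => trivial⟩
  have hpow : 1 < (n + 1) ^ K := Nat.one_lt_pow (by omega) (by omega)
  have hpow' : (1 : ℝ) < ((n + 1 : ℕ) : ℝ) ^ K := by exact_mod_cast hpow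
  have hlog : ∀ d : ℕ, Real.logb 2 ((2 ^ d : ℕ) : ℝ) = d := by
    intro d
    rw [Nat.cast_pow, Nat.cast_ofNat, Real.logb_pow, Real.logb_self_eq_one one_lt_two, mul_one]
  have hcardA : Fintype.card (T → Fin n → ZMod 2) = 2 ^ (n * (n + 1) ^ K) := by
    rw [Fintype.card_fun, Fintype.card_fun, hT, ZMod.card, Fintype.card_fin, ← pow_mul]
  have hsource : ∀ k, entropy (ProbabilityTheory.uniformOn Set.univ)
      (fun ω : Fin K → T → Fin n → ZMod 2 => ω k) = ((n * (n + 1) ^ K : ℕ) : ℝ) := by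
    intro k
    have h := entropy_uniformOn_hom
      (Pi.evalAddMonoidHom (fun _ : Fin K => T → Fin n → ZMod 2) k) Finset.univ
      fun y => ⟨fun _ => ⟨fun _ => y, rfl⟩, fun _ => Finset.mem_univ y⟩
    rw [Finset.card_univ, hcardA, hlog] at h
    exact h
  refine ⟨Fin K → T → Fin n → ZMod 2, T → Fin n → ZMod 2, T → ZMod 2, ⊤, inferInstance,
    inferInstance, ProbabilityTheory.uniformOn Set.univ, fun k ω => ω k,
    fun v m => gridSymbol (e.symm m) v, gridLines n K _ e, (n * (n + 1) ^ K : ℕ),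
    ((n + 1) ^ K - 1 : ℕ), ?_, gridLines_smooth, ?_, ?_⟩
  · constructor
    · exact ProbabilityTheory.isProbabilityMeasure_uniformOn Set.finite_univ Set.univ_nonempty
    · exact fun k a => trivial
    · rw [Finset.sum_congr rfl fun k _ => hsource k, Finset.sum_const, Finset.card_univ,
        Fintype.card_fin, nsmul_eq_mul]
      have h := entropy_uniformOn_hom (AddMonoidHom.id (Fin K → T → Fin n → ZMod 2)) Finset.univ
        fun y => ⟨fun _ => ⟨y, rfl⟩, fun _ => Finset.mem_univ y⟩
      rw [Finset.card_univ, Fintype.card_fun, hcardA, Fintype.card_fin, ← pow_mul, hlog] at h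
      refine Eq.trans h ?_
      push_cast
      ring
    · exact hsource
    · intro m
      have h := entropy_uniformOn_hom (gridSymbol (e.symm m))
        (Fintype.piFinset fun t : T => if t = e.symm m then {0} else Finset.univ) fun y => by
          rw [gridSymbol_range, Fintype.mem_piFinset]
          constructor
          · intro hy
            simpa using hy (e.symm m)
          · intro hy t
            by_cases ht : t = e.symm m
            · subst ht
              simp [hy]
            · simp [ht]
      refine Eq.trans h ?_
      rw [Fintype.card_piFinset, ← hlog ((n + 1) ^ K - 1)]
      congr 2
      rw [← Finset.mul_prod_erase _ _ (Finset.mem_univ (e.symm m)), if_pos rfl,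
        Finset.card_singleton, one_mul, Finset.prod_congr rfl fun t ht => by
          rw [if_neg (Finset.ne_of_mem_erase ht), Finset.card_univ, ZMod.card],
        Finset.prod_const, Finset.card_erase_of_mem (Finset.mem_univ _), Finset.card_univ, hT]
    · exact fun k => Finset.univ_nonempty.image _
    · intro k S hS
      obtain ⟨F, -, rfl⟩ := Finset.mem_image.1 hS
      rw [Finset.card_image_of_injective _ fun i i' h =>
        Function.update_injective F k (e.injective h), Finset.card_univ, Fintype.card_fin]
    · intro k S hS
      obtain ⟨F, -, rfl⟩ := Finset.mem_image.1 hS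
      refine condEntropy_eq_zero _ fun u v huv => gridSymbol_decode k F fun i => ?_
      have h := congrFun huv
        ⟨e (Function.update F k i), Finset.mem_image_of_mem _ (Finset.mem_univ i)⟩
      simpa [codedSymbol] using h
  · exact_mod_cast Nat.sub_pos_of_lt hpow
  · have hn' : (1 : ℝ) ≤ n := by exact_mod_cast hn
    rw [sum_one_div_pow_eq (by omega), Nat.cast_sub hpow.le]
    push_cast at hpow' ⊢
    have h1 : ((n : ℝ) + 1) ^ K - 1 ≠ 0 := by linarith
    rw [inv_div]
    field_simp
    ring

/-- For `N = 1` the single coded symbol that lists all source symbols has maximal rate. -/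
lemma single_rate_mem (K : ℕ) (hK : 1 ≤ K) :
    ((1 : ℕ) : ℝ) * (∑ i ∈ Finset.range K, 1 / ((1 : ℕ) : ℝ) ^ i)⁻¹ ∈ smoothRates 1 K (1 ^ K) := by
  rw [one_pow]
  let _ : MeasurableSpace (Fin K → ZMod 2) := ⊤
  have : DiscreteMeasurableSpace (Fin K → ZMod 2) := ⟨fun _ => trivial⟩
  have hsource : ∀ k, entropy (ProbabilityTheory.uniformOn Set.univ)
      (fun ω : Fin K → ZMod 2 => ω k) = 1 := by
    intro k
    have h := entropy_uniformOn_hom (Pi.evalAddMonoidHom (fun _ : Fin K => ZMod 2) k) Finset.univ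
      fun y => ⟨fun _ => ⟨fun _ => y, rfl⟩, fun _ => Finset.mem_univ y⟩
    rw [Finset.card_univ, ZMod.card, Nat.cast_ofNat, Real.logb_self_eq_one one_lt_two] at h
    exact h
  have hall : entropy (ProbabilityTheory.uniformOn Set.univ)
      (fun ω : Fin K → ZMod 2 => ω) = K := by
    have h := entropy_uniformOn_hom (AddMonoidHom.id (Fin K → ZMod 2)) Finset.univ
      fun y => ⟨fun _ => ⟨y, rfl⟩, fun _ => Finset.mem_univ y⟩
    rw [Finset.card_univ, Fintype.card_fun, ZMod.card, Fintype.card_fin, Nat.cast_pow,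
      Nat.cast_ofNat, Real.logb_pow, Real.logb_self_eq_one one_lt_two, mul_one] at h
    exact h
  refine ⟨Fin K → ZMod 2, ZMod 2, Fin K → ZMod 2, ⊤, inferInstance, inferInstance,
    ProbabilityTheory.uniformOn Set.univ, fun k ω => ω k, fun v _ => v, fun _ => {Finset.univ},
    1, K, ?_, ?_, ?_, ?_⟩
  · constructor
    · exact ProbabilityTheory.isProbabilityMeasure_uniformOn Set.finite_univ Set.univ_nonempty
    · exact fun k a => trivial
    · refine hall.trans ?_
      rw [Finset.sum_congr rfl fun k _ => hsource k]
      simp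
    · exact hsource
    · exact fun _ => hall
    · exact fun _ => Finset.singleton_nonempty _
    · intro k S hS
      rw [Finset.mem_singleton.1 hS]
      simp
    · intro k S hS
      rw [Finset.mem_singleton.1 hS]
      refine condEntropy_eq_zero _ fun u v huv => ?_
      have h := congrFun huv ⟨0, Finset.mem_univ 0⟩
      exact congrFun h k
  · intro k m m'
    rw [Subsingleton.elim m m']
  · exact_mod_cast hK
  · simp

/-! ### The capacity -/

lemma maxRate_mem (N K : ℕ) (hN : 1 ≤ N) (hK : 1 ≤ K) :
    (N : ℝ) * (∑ i ∈ Finset.range K, 1 / (N : ℝ) ^ i)⁻¹ ∈ smoothRates N K (N ^ K) := by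
  obtain ⟨n, rfl⟩ := Nat.exists_eq_add_of_le' hN
  rcases Nat.eq_zero_or_pos n with rfl | hn
  · exact single_rate_mem K hK
  · exact grid_rate_mem n K hn hK

/-- The rates of the profiles with the combinatorial data of a smooth code. -/
def profileRates (N K M : ℕ) : Set ℝ :=
  ⋃ 𝒮 ∈ {𝒮 : Fin K → Finset (Finset (Fin M)) | PerfectlySmooth 𝒮 ∧ (∀ k, (𝒮 k).Nonempty) ∧
    ∀ k, ∀ S ∈ 𝒮 k, S.card = N}, {w | ∃ g, IsProfile 𝒮 w g}

lemma isClosed_iUnion_profileRates (N K M : ℕ) : IsClosed (profileRates N K M) :=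
  (Set.toFinite _).isClosed_biUnion fun 𝒮 _ => isClosed_profileRates 𝒮

lemma smoothRates_subset (N K M : ℕ) : smoothRates N K M ⊆ profileRates N K M := by
  rintro r ⟨Ω, A, B, _, _, _, P, W, enc, 𝒮, Lw, Lx, h, hsm, hLx, rfl⟩
  exact Set.mem_biUnion (x := 𝒮) ⟨hsm, h.nonempty, h.card_eq⟩ ⟨_, h.isProfile hLx⟩

section

variable {N K M : ℕ}

lemma length_pos (hN : 1 ≤ N) (hK : 1 ≤ K) {𝒮 : Fin K → Finset (Finset (Fin M))}
    (hne : ∀ k, (𝒮 k).Nonempty) (hcard : ∀ k, ∀ S ∈ 𝒮 k, S.card = N) : 0 < M := by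
  obtain ⟨S, hS⟩ := hne ⟨0, hK⟩
  have h1 := Finset.card_le_univ S
  rw [hcard _ S hS, Fintype.card_fin] at h1
  exact hN.trans h1

lemma le_of_mem_profileRates (hN : 1 ≤ N) (hK : 1 ≤ K) {w : ℝ} (hw : w ∈ profileRates N K M) :
    w ≤ (N : ℝ) * (∑ i ∈ Finset.range K, 1 / (N : ℝ) ^ i)⁻¹ := by
  obtain ⟨𝒮, ⟨hsm, hne, hcard⟩, g, hg⟩ := Set.mem_iUnion₂.1 hw
  exact hg.rate_le hsm hN hK (length_pos hN hK hne hcard) hne hcard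

lemma pow_le_of_mem_profileRates (hN : 1 ≤ N) (hK : 1 ≤ K)
    (hw : (N : ℝ) * (∑ i ∈ Finset.range K, 1 / (N : ℝ) ^ i)⁻¹ ∈ profileRates N K M) :
    N ^ K ≤ M := by
  obtain ⟨𝒮, ⟨hsm, hne, hcard⟩, g, hg⟩ := Set.mem_iUnion₂.1 hw
  refine hg.pow_le_length hsm hN (length_pos hN hK hne hcard) hne hcard ?_
  have : 0 < ∑ i ∈ Finset.range K, 1 / (N : ℝ) ^ i :=
    Finset.sum_pos (fun i _ => by positivity) ⟨0, Finset.mem_range.2 hK⟩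
  field_simp

lemma smoothCapacity_le (hN : 1 ≤ N) (hK : 1 ≤ K) :
    smoothCapacity N K M
      ≤ (((N : ℝ) * (∑ i ∈ Finset.range K, 1 / (N : ℝ) ^ i)⁻¹ : ℝ) : EReal) := by
  refine sSup_le ?_
  rintro _ ⟨r, hr, rfl⟩
  exact EReal.coe_le_coe_iff.2 (le_of_mem_profileRates hN hK (smoothRates_subset N K M hr))

/-- A maximal supremum of rates is a limit of rates, hence the rate of a profile. -/
lemma pow_le_of_smoothCapacity_eq (hN : 1 ≤ N) (hK : 1 ≤ K)
    (h : smoothCapacity N K M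
      = (((N : ℝ) * (∑ i ∈ Finset.range K, 1 / (N : ℝ) ^ i)⁻¹ : ℝ) : EReal)) :
    N ^ K ≤ M := by
  refine pow_le_of_mem_profileRates hN hK ?_
  rw [← (isClosed_iUnion_profileRates N K M).closure_eq]
  refine closure_mono (smoothRates_subset N K M) (Metric.mem_closure_iff.2 fun ε hε => ?_)
  set c : ℝ := (N : ℝ) * (∑ i ∈ Finset.range K, 1 / (N : ℝ) ^ i)⁻¹ with hc
  have hlt : ((c - ε : ℝ) : EReal) < smoothCapacity N K M := by
    rw [h]
    exact EReal.coe_lt_coe_iff.2 (by linarith)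
  obtain ⟨_, ⟨r, hr, rfl⟩, hr'⟩ := lt_sSup_iff.1 hlt
  have h1 : c - ε < r := EReal.coe_lt_coe_iff.1 hr'
  have h2 : r ≤ c := le_of_mem_profileRates hN hK (smoothRates_subset N K M hr)
  refine ⟨r, hr, ?_⟩
  rw [Real.dist_eq, abs_of_nonneg (by linarith)]
  linarith

end

theorem corollary3 (N K : ℕ) (hN : 1 ≤ N) (hK : 1 ≤ K) :
    -- the value of the maximal capacity
    maxSmoothCapacity N K
        = (((N : ℝ) * (∑ i ∈ Finset.range K, 1 / (N : ℝ) ^ i)⁻¹ : ℝ) : EReal) ∧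
    -- the least code length whose capacity (a supremum) is maximal
    IsLeast {M : ℕ | smoothCapacity N K M = maxSmoothCapacity N K} (N ^ K) ∧
    -- the least length of a single code whose rate is the maximal capacity
    IsLeast {M : ℕ | ∃ r ∈ smoothRates N K M, (r : EReal) = maxSmoothCapacity N K} (N ^ K) := by
  have hmem := maxRate_mem N K hN hK
  have hcap : smoothCapacity N K (N ^ K)
      = (((N : ℝ) * (∑ i ∈ Finset.range K, 1 / (N : ℝ) ^ i)⁻¹ : ℝ) : EReal) :=
    le_antisymm (smoothCapacity_le hN hK) (le_sSup ⟨_, hmem, rfl⟩)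
  have hmax : maxSmoothCapacity N K
      = (((N : ℝ) * (∑ i ∈ Finset.range K, 1 / (N : ℝ) ^ i)⁻¹ : ℝ) : EReal) :=
    le_antisymm (iSup_le fun _ => smoothCapacity_le hN hK)
      (hcap.symm.trans_le (le_iSup (smoothCapacity N K) (N ^ K)))
  rw [hmax]
  refine ⟨rfl, ⟨hcap, fun M hM => pow_le_of_smoothCapacity_eq hN hK hM⟩, ⟨_, hmem, rfl⟩, ?_⟩
  rintro M ⟨r, hr, hrc⟩
  rw [EReal.coe_eq_coe_iff] at hrc
  subst hrc
  exact pow_le_of_mem_profileRates hN hK (smoothRates_subset N K M hr)
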